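/- Let $\Lambda$ be a left and right noetherian ring (associative, with $1$), and let $0\to\Lambda\to I_0\to I_1\to\cdots\to I_i\to\cdots$ be a minimal injective resolution of $\Lambda$ as a right $\Lambda$-module, that is, an injective resolution in which $\operatorname{Ker}(I_i\to I_{i+1})$ is an essential submodule of $I_i$ for every $i\ge 0$. For a finitely generated right $\Lambda$-module $N$, let $\operatorname{grade} N$ be the least integer $t\ge 0$ with $\operatorname{Ext}^t_\Lambda(N,\Lambda)\ne 0$, and put $\operatorname{grade} N=\infty$ if $\operatorname{Ext}^t_\Lambda(N,\Lambda)=0$ for all $t\ge 0$. Suppose that for every $i\ge 0$ the right $\Lambda$-module $I_i$ has finite flat dimension (the bound is allowed to depend on $i$). Then the following statements are equivalent. (1) For every finitely generated right $\Lambda$-module $N$, $\operatorname{grade} N=\infty$ implies $N=0$. (2) $\operatorname{grade} S<\infty$ for every simple right $\Lambda$-module $S$. (3) $\bigoplus_{i\ge 0} I_i$ is an injective cogenerator for the category of right $\Lambda$-modules. -/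

import Mathlib

open CategoryTheory TensorProduct

universe u

/-! Right `Λ`-modules are modules over `Λᵐᵒᵖ`; `MulOpposite.op a • m` is the product `m * a`. -/

noncomputable section

/-! ### Tensor products over a noncommutative ring and flat dimension -/

/-- The subgroup of `M ⊗[ℤ] N` generated by the elements `(m * a) ⊗ n - m ⊗ (a * n)`. -/
def balancedRelations (Λ : Type u) [Ring Λ] (M : Type u) [AddCommGroup M] [Module Λᵐᵒᵖ M]
    (N : Type u) [AddCommGroup N] [Module Λ N] : AddSubgroup (M ⊗[ℤ] N) :=
  AddSubgroup.closure
    {t | ∃ (m : M) (a : Λ) (n : N), t = (MulOpposite.op a • m) ⊗ₜ[ℤ] n - m ⊗ₜ[ℤ] (a • n)}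

/-- The abelian group `M ⊗_Λ N`, for a right `Λ`-module `M` and a left `Λ`-module `N`. -/
abbrev BalancedTensor (Λ : Type u) [Ring Λ] (M : Type u) [AddCommGroup M] [Module Λᵐᵒᵖ M]
    (N : Type u) [AddCommGroup N] [Module Λ N] : Type u :=
  (M ⊗[ℤ] N) ⧸ balancedRelations Λ M N

/-- The map `M ⊗_Λ f : M ⊗_Λ N → M ⊗_Λ P`, `m ⊗ n ↦ m ⊗ f n`. -/
def BalancedTensor.lTensor (Λ : Type u) [Ring Λ] (M : Type u) [AddCommGroup M] [Module Λᵐᵒᵖ M]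
    {N P : Type u} [AddCommGroup N] [Module Λ N] [AddCommGroup P] [Module Λ P] (f : N →ₗ[Λ] P) :
    BalancedTensor Λ M N →+ BalancedTensor Λ M P :=
  QuotientAddGroup.map (balancedRelations Λ M N) (balancedRelations Λ M P)
    (LinearMap.lTensor M f.toAddMonoidHom.toIntLinearMap).toAddMonoidHom <| by
    refine (AddSubgroup.closure_le _).2 ?_
    rintro _ ⟨m, a, n, rfl⟩
    exact AddSubgroup.subset_closure ⟨m, a, f n, by simp⟩

/-- A right `Λ`-module `M` is flat if `M ⊗_Λ -` preserves injectivity of homomorphisms of left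
`Λ`-modules. -/
def IsFlatRight (Λ : Type u) [Ring Λ] (M : ModuleCat.{u} Λᵐᵒᵖ) : Prop :=
  ∀ (N P : Type u) [AddCommGroup N] [Module Λ N] [AddCommGroup P] [Module Λ P] (f : N →ₗ[Λ] P),
    Function.Injective f → Function.Injective (BalancedTensor.lTensor Λ M f)

/-- `M` has a flat resolution `0 → F_n → ⋯ → F_0 → M → 0`. Such a resolution is the same as a
surjection `F_0 → M` with `F_0` flat, together with a flat resolution of length `n - 1` of its
kernel. -/
def HasFlatResolutionOfLength (Λ : Type u) [Ring Λ] : ℕ → ModuleCat.{u} Λᵐᵒᵖ → Prop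
  | 0, M => IsFlatRight Λ M
  | n + 1, M => ∃ (F : ModuleCat.{u} Λᵐᵒᵖ) (p : F →ₗ[Λᵐᵒᵖ] M), IsFlatRight Λ F ∧
      Function.Surjective p ∧ HasFlatResolutionOfLength Λ n (ModuleCat.of Λᵐᵒᵖ (LinearMap.ker p))

/-- The flat dimension of a right `Λ`-module: the least length of a flat resolution, `⊤` if there
is no finite one. -/
def rightFlatDimension (Λ : Type u) [Ring Λ] (M : ModuleCat.{u} Λᵐᵒᵖ) : ℕ∞ :=
  ⨅ (n : ℕ) (_ : HasFlatResolutionOfLength Λ n M), (n : ℕ∞)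

/-! ### Grade -/

/-- The grade of a right `Λ`-module `N`: the least `t` with `Ext^t_Λ(N, Λ) ≠ 0`, and `⊤` if
`Ext^t_Λ(N, Λ) = 0` for all `t ≥ 0`. -/
def rightGrade (Λ : Type u) [Ring Λ] (N : ModuleCat.{u} Λᵐᵒᵖ) : ℕ∞ :=
  ⨅ (t : ℕ) (_ : Nontrivial (Abelian.Ext.{u} N (ModuleCat.of Λᵐᵒᵖ Λ) t)), (t : ℕ∞)

/-! ### Minimal injective resolutions -/

/-- A submodule `K` of `M` is essential if it meets every nonzero submodule of `M`
nontrivially. -/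
def IsEssentialSubmodule {R : Type u} [Ring R] {M : Type u} [AddCommGroup M] [Module R M]
    (K : Submodule R M) : Prop :=
  ∀ U : Submodule R M, U ⊓ K = ⊥ → U = ⊥

/-- An injective resolution `0 → M → I_0 → I_1 → ⋯` is minimal if every `I_i` is an injective
envelope of `Ker (I_i → I_{i+1})`, that is, of `M` for `i = 0` and of the image of `I_{i-1}`
for `i > 0`. -/
def IsMinimalInjectiveResolution {R : Type u} [Ring R] {M : ModuleCat.{u} R}
    (I : InjectiveResolution M) : Prop :=
  ∀ i : ℕ, IsEssentialSubmodule (LinearMap.ker (I.cocomplex.d i (i + 1)).hom)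

end

/-! The substance is (3) ⇒ (1). If `N` is finitely generated of infinite grade, `Ext(N, F)` vanishes
for flat `F`: after syzygies reduce to low degrees, this is `exists_extension_of_isFlatRight`.
Dimension shifting along flat resolutions gives `Hom(N, I_i) = 0` for all `i`, so a cogenerator `⊕
I_i` forces `N = 0`. For (2) ⇒ (3), a nonzero class in `Ext^t(S, Λ)` is represented by a nonzero map
`S → I_t`, and an injective module receiving nonzero maps from all simples is a cogenerator. -/

/-- The pure tensors `m ⊗ n` in `M ⊗_Λ N`. -/
def BalancedTensor.mk (Λ : Type u) [Ring Λ] (M : Type u) [AddCommGroup M] [Module Λᵐᵒᵖ M]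
    (N : Type u) [AddCommGroup N] [Module Λ N] : M →+ N →+ BalancedTensor Λ M N :=
  AddMonoidHom.mk' (fun m => AddMonoidHom.mk' (fun n => QuotientAddGroup.mk (m ⊗ₜ[ℤ] n))
    fun _ _ => by rw [TensorProduct.tmul_add, QuotientAddGroup.mk_add])
    fun _ _ => by
      ext
      simp [TensorProduct.add_tmul]

theorem BalancedTensor.mk_smul {Λ : Type u} [Ring Λ] {M : Type u} [AddCommGroup M]
    [Module Λᵐᵒᵖ M] {N : Type u} [AddCommGroup N] [Module Λ N] (m : M) (a : Λ) (n : N) :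
    BalancedTensor.mk Λ M N m (a • n) = BalancedTensor.mk Λ M N (MulOpposite.op a • m) n := by
  refine QuotientAddGroup.eq.2 ?_
  rw [neg_add_eq_sub]
  exact AddSubgroup.subset_closure ⟨m, a, n, rfl⟩

theorem BalancedTensor.lTensor_mk {Λ : Type u} [Ring Λ] {M : Type u} [AddCommGroup M]
    [Module Λᵐᵒᵖ M] {N P : Type u} [AddCommGroup N] [Module Λ N] [AddCommGroup P] [Module Λ P]
    (f : N →ₗ[Λ] P) (m : M) (n : N) :
    BalancedTensor.lTensor Λ M f (BalancedTensor.mk Λ M N m n) =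
      BalancedTensor.mk Λ M P m (f n) := rfl

/-- A biadditive balanced map induces a homomorphism on the tensor product. -/
def BalancedTensor.lift {Λ : Type u} [Ring Λ] {M : Type u} [AddCommGroup M]
    [Module Λᵐᵒᵖ M] {N : Type u} [AddCommGroup N] [Module Λ N] {X : Type*} [AddCommGroup X]
    (b : M →+ N →+ X) (hb : ∀ m (a : Λ) n, b (MulOpposite.op a • m) n = b m (a • n)) :
    BalancedTensor Λ M N →+ X :=
  QuotientAddGroup.lift _ (TensorProduct.liftAddHom b fun r m n => by simp) <| by
    refine (AddSubgroup.closure_le _).2 ?_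
    rintro _ ⟨m, a, n, rfl⟩
    simp [hb]

/-! ### Extending homomorphisms into flat modules -/

/-- The homomorphism `q ↦ x * φ q` given by an element `x` of `F` and a linear form `φ` on `Q`. -/
def dyad {Λ : Type u} [Ring Λ] {Q F : Type u} [AddCommGroup Q] [Module Λᵐᵒᵖ Q] [AddCommGroup F]
    [Module Λᵐᵒᵖ F] : F →+ (Q →ₗ[Λᵐᵒᵖ] Λ) →+ (Q →ₗ[Λᵐᵒᵖ] F) :=
  AddMonoidHom.mk' (fun x => AddMonoidHom.mk' (fun φ =>
    { toFun := fun q => MulOpposite.op (φ q) • x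
      map_add' := fun _ _ => by simp [add_smul]
      map_smul' := fun c q => by
        rw [map_smul, ← MulOpposite.op_unop c, op_smul_eq_mul, MulOpposite.op_mul, mul_smul]
        rfl })
    fun _ _ => by ext; simp [add_smul])
    fun _ _ => by ext; simp

theorem dyad_apply {Λ : Type u} [Ring Λ] {Q F : Type u} [AddCommGroup Q] [Module Λᵐᵒᵖ Q]
    [AddCommGroup F] [Module Λᵐᵒᵖ F] (x : F) (φ : Q →ₗ[Λᵐᵒᵖ] Λ) (q : Q) :
    dyad x φ q = MulOpposite.op (φ q) • x := rfl

/-- If every linear form on the finitely presented module `G` extends along `g : G → R`, then so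
does every homomorphism from `G` to a flat module. -/
theorem exists_extension_of_isFlatRight {Λ : Type u} [Ring Λ] [IsNoetherianRing Λᵐᵒᵖ]
    {G R : Type u} [AddCommGroup G] [Module Λᵐᵒᵖ G] [Module.Finite Λᵐᵒᵖ G] [AddCommGroup R]
    [Module Λᵐᵒᵖ R] (g : G →ₗ[Λᵐᵒᵖ] R)
    (hg : ∀ φ : G →ₗ[Λᵐᵒᵖ] Λ, ∃ ψ : R →ₗ[Λᵐᵒᵖ] Λ, ψ ∘ₗ g = φ)
    (F : ModuleCat.{u} Λᵐᵒᵖ) (hF : IsFlatRight Λ F) (f : G →ₗ[Λᵐᵒᵖ] F) :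
    ∃ h : R →ₗ[Λᵐᵒᵖ] F, h ∘ₗ g = f := by
  obtain ⟨k, π, hπ⟩ := Module.Finite.exists_fin' Λᵐᵒᵖ G
  obtain ⟨m, d, hd⟩ :=
    Submodule.fg_iff_exists_fin_generating_family.1 (IsNoetherian.noetherian (LinearMap.ker π))
  let A : Submodule Λ ((Fin k → Λᵐᵒᵖ) →ₗ[Λᵐᵒᵖ] Λ) :=
    { carrier := {φ | ∃ ψ : R →ₗ[Λᵐᵒᵖ] Λ, ψ ∘ₗ g ∘ₗ π = φ}
      add_mem' := by
        rintro _ _ ⟨a, rfl⟩ ⟨b, rfl⟩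
        exact ⟨a + b, rfl⟩
      zero_mem' := ⟨0, rfl⟩
      smul_mem' := by
        rintro c _ ⟨a, rfl⟩
        exact ⟨c • a, rfl⟩ }
  let ev : ((Fin k → Λᵐᵒᵖ) →ₗ[Λᵐᵒᵖ] Λ) →ₗ[Λ] (Fin m → Λ) :=
    { toFun := fun φ i => φ (d i)
      map_add' := fun _ _ => rfl
      map_smul' := fun _ _ => rfl }
  have hdπ : ∀ i, π (d i) = 0 := fun i =>
    LinearMap.mem_ker.1 (hd ▸ Submodule.subset_span ⟨i, rfl⟩)
  -- A form vanishing on the relations `d i` descends to `G`, hence extends to `R` by `hg`. So the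
  -- quotient by `A` embeds in `Λ^m`, where flatness of `F` applies.
  have hA : A = LinearMap.ker ev := by
    apply le_antisymm
    · rintro _ ⟨a, rfl⟩
      rw [LinearMap.mem_ker]
      ext i
      simp [ev, hdπ]
    · intro φ hφ
      have hker : LinearMap.ker π ≤ LinearMap.ker φ := by
        rw [← hd, Submodule.span_le]
        rintro _ ⟨i, rfl⟩
        exact congrFun (LinearMap.mem_ker.1 hφ) i
      obtain ⟨φ', hφ'⟩ : ∃ φ' : G →ₗ[Λᵐᵒᵖ] Λ, φ' ∘ₗ π = φ := by
        refine ⟨(LinearMap.ker π).liftQ φ hker ∘ₗ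
          (π.quotKerEquivOfSurjective hπ).symm.toLinearMap, ?_⟩
        ext q
        simp
      obtain ⟨ψ, hψ⟩ := hg φ'
      exact ⟨ψ, by rw [← LinearMap.comp_assoc, hψ, hφ']⟩
  let ev' : (((Fin k → Λᵐᵒᵖ) →ₗ[Λᵐᵒᵖ] Λ) ⧸ A) →ₗ[Λ] (Fin m → Λ) := A.liftQ ev hA.le
  have hev' : Function.Injective ev' := by
    rw [← LinearMap.ker_eq_bot]
    exact Submodule.ker_liftQ_eq_bot _ _ _ hA.ge
  let e : Fin k → ((Fin k → Λᵐᵒᵖ) →ₗ[Λᵐᵒᵖ] Λ) := fun j =>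
    { toFun := fun q => MulOpposite.unop (q j)
      map_add' := fun _ _ => rfl
      map_smul' := fun _ _ => rfl }
  have hf : ∀ q : Fin k → Λᵐᵒᵖ, f (π q) = ∑ j, q j • f (π (Pi.single j 1)) := by
    intro q
    conv_lhs => rw [pi_eq_sum_univ' q]
    simp [map_sum]
  -- This tensor encodes `f ∘ π`. Its image in `F ⊗ Λ^m` has coordinates `f (π (d i)) = 0`.
  let t : BalancedTensor Λ F (((Fin k → Λᵐᵒᵖ) →ₗ[Λᵐᵒᵖ] Λ) ⧸ A) :=
    ∑ j, BalancedTensor.mk Λ F _ (f (π (Pi.single j 1))) (A.mkQ (e j))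
  have ht : t = 0 := by
    apply hF _ _ ev' hev'
    have hev : ∀ j, ev' (A.mkQ (e j)) =
        ∑ i, MulOpposite.unop (d i j) • (Pi.single i 1 : Fin m → Λ) := by
      intro j
      rw [← pi_eq_sum_univ' fun i => MulOpposite.unop (d i j)]
      rfl
    simp only [t, map_sum, map_zero, BalancedTensor.lTensor_mk, hev, BalancedTensor.mk_smul,
      MulOpposite.op_unop]
    rw [Finset.sum_comm]
    refine Finset.sum_eq_zero fun i _ => ?_
    rw [← AddMonoidHom.finsetSum_apply, ← map_sum, ← hf, hdπ, map_zero, map_zero,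
      AddMonoidHom.zero_apply]
  let B : AddSubgroup ((Fin k → Λᵐᵒᵖ) →ₗ[Λᵐᵒᵖ] F) :=
    (LinearMap.lcomp ℤ F (g ∘ₗ π)).range.toAddSubgroup
  -- `B` consists of the maps factoring through `g ∘ π`. The map induced by `b` sends `t` to the
  -- class of `f ∘ π`, so `t = 0` yields the extension.
  let b : F →+ (((Fin k → Λᵐᵒᵖ) →ₗ[Λᵐᵒᵖ] Λ) ⧸ A) →+ ((Fin k → Λᵐᵒᵖ) →ₗ[Λᵐᵒᵖ] F) ⧸ B :=
    AddMonoidHom.mk' (fun x => QuotientAddGroup.map A.toAddSubgroup B (dyad x) (by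
      rintro _ ⟨ψ, rfl⟩
      exact ⟨dyad x ψ, rfl⟩)) (by
      intro x y
      ext φ
      obtain ⟨φ, rfl⟩ := A.mkQ_surjective φ
      exact congrArg (QuotientAddGroup.mk (s := B)) (congrArg (· φ) (map_add dyad x y)))
  have hb : ∀ x (a : Λ) n, b (MulOpposite.op a • x) n = b x (a • n) := by
    intro x a φ
    obtain ⟨φ, rfl⟩ := A.mkQ_surjective φ
    refine congrArg (QuotientAddGroup.mk (s := B)) (LinearMap.ext fun q => ?_)
    simp [dyad_apply, mul_smul]
  have hlift := congrArg (BalancedTensor.lift b hb) ht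
  rw [map_zero, map_sum] at hlift
  have hsum : (QuotientAddGroup.mk (∑ j, dyad (f (π (Pi.single j 1))) (e j)) : _ ⧸ B) = 0 := by
    rw [← hlift]
    exact map_sum (QuotientAddGroup.mk' B) _ _
  have hfπ : ∑ j, dyad (f (π (Pi.single j 1))) (e j) = f ∘ₗ π := by
    refine LinearMap.ext fun q => ?_
    rw [LinearMap.sum_apply, LinearMap.comp_apply, hf q]
    rfl
  rw [hfπ, QuotientAddGroup.eq_zero_iff] at hsum
  obtain ⟨h, hh⟩ := hsum
  refine ⟨h, LinearMap.ext fun x => ?_⟩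
  obtain ⟨q, rfl⟩ := hπ x
  exact LinearMap.congr_fun hh q

/-! ### Vanishing of Ext -/

theorem subsingleton_ext_zero_iff {R : Type u} [Ring R] (N M : ModuleCat.{u} R) :
    Subsingleton (Abelian.Ext.{u} N M 0) ↔ ∀ f : N →ₗ[R] M, f = 0 := by
  rw [(Abelian.Ext.homEquiv₀.trans ModuleCat.homEquiv).subsingleton_congr]
  exact ⟨fun h f => Subsingleton.elim _ _, fun h => ⟨fun f g => (h f).trans (h g).symm⟩⟩

/-- Vanishing of `Ext^i(N, Λ)` forces vanishing of `Ext^i(N, F)` for every flat module `F`. -/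
theorem subsingleton_ext_of_isFlatRight {Λ : Type u} [Ring Λ] [IsNoetherianRing Λᵐᵒᵖ]
    (F : ModuleCat.{u} Λᵐᵒᵖ) (hF : IsFlatRight Λ F) (i : ℕ) (N : ModuleCat.{u} Λᵐᵒᵖ)
    [Module.Finite Λᵐᵒᵖ N]
    (hN : Subsingleton (Abelian.Ext.{u} N (ModuleCat.of Λᵐᵒᵖ Λ) i)) :
    Subsingleton (Abelian.Ext.{u} N F i) := by
  induction i generalizing N with
  | zero =>
    rw [subsingleton_ext_zero_iff] at hN ⊢
    intro f
    obtain ⟨h, rfl⟩ := exists_extension_of_isFlatRight (0 : N →ₗ[Λᵐᵒᵖ] PUnit.{u + 1})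
      (fun φ => ⟨0, (hN φ).symm⟩) F hF f
    simp
  | succ n ih =>
    obtain ⟨k, f, hf⟩ := Module.Finite.exists_fin' Λᵐᵒᵖ N
    have hS := LinearMap.shortExact_shortComplexKer hf
    have : Projective f.shortComplexKer.X₂ :=
      ModuleCat.projective_of_free (Pi.basisFun Λᵐᵒᵖ (Fin k))
    refine subsingleton_of_forall_eq 0 fun x => ?_
    obtain ⟨y, rfl⟩ := precomp_extClass_surjective_of_projective_X₂ F hS n x
    change hS.extClass.comp y (add_comm 1 n) = 0
    cases n with
    -- Dimension shifting stops here, since `Hom(K, Λ)` need not vanish for the syzygy `K`. Instead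
    -- `Ext^1(N, Λ) = 0` says that forms on `K` extend to the free cover; hence so do maps `K → F`.
    | zero =>
      obtain ⟨y, rfl⟩ := (Abelian.Ext.mk₀_bijective _ _).2 y
      obtain ⟨h, hh⟩ := exists_extension_of_isFlatRight (LinearMap.ker f).subtype (fun φ => by
        obtain ⟨z, hz⟩ := Abelian.Ext.contravariant_sequence_exact₁ hS (ModuleCat.of Λᵐᵒᵖ Λ)
          (Abelian.Ext.mk₀ (ModuleCat.ofHom φ)) (add_comm 1 0) (Subsingleton.elim _ _)
        obtain ⟨z, rfl⟩ := (Abelian.Ext.mk₀_bijective _ _).2 z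
        rw [Abelian.Ext.mk₀_comp_mk₀] at hz
        exact ⟨z.hom, congrArg ModuleCat.Hom.hom ((Abelian.Ext.mk₀_bijective _ _).1 hz)⟩) F hF y.hom
      have hy : y = f.shortComplexKer.f ≫ ModuleCat.ofHom h := ModuleCat.hom_ext hh.symm
      rw [hy, ← Abelian.Ext.mk₀_comp_mk₀]
      exact hS.extClass_comp_assoc _
    | succ k =>
      have hK : Subsingleton (Abelian.Ext.{u} f.shortComplexKer.X₁ (ModuleCat.of Λᵐᵒᵖ Λ) (k + 1)) :=
        subsingleton_of_forall_eq 0 fun z => by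
          obtain ⟨w, rfl⟩ := Abelian.Ext.contravariant_sequence_exact₁ hS _ z
            (add_comm 1 (k + 1)) (Subsingleton.elim _ _)
          rw [w.eq_zero_of_projective, Abelian.Ext.comp_zero]
      have : Module.Finite Λᵐᵒᵖ f.shortComplexKer.X₁ :=
        inferInstanceAs (Module.Finite Λᵐᵒᵖ (LinearMap.ker f))
      have := ih _ hK
      rw [Subsingleton.elim y 0, Abelian.Ext.comp_zero]

/-- For `0 → K → F → M → 0`, exactness places `Ext^i(N, M)` between `Ext^i(N, F)` and `Ext^(i+1)(N,
K)`; the degree must therefore vary in the induction. -/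
theorem subsingleton_ext_of_hasFlatResolutionOfLength {Λ : Type u} [Ring Λ]
    [IsNoetherianRing Λᵐᵒᵖ] (N : ModuleCat.{u} Λᵐᵒᵖ) [Module.Finite Λᵐᵒᵖ N]
    (hN : ∀ i, Subsingleton (Abelian.Ext.{u} N (ModuleCat.of Λᵐᵒᵖ Λ) i)) (n : ℕ)
    (M : ModuleCat.{u} Λᵐᵒᵖ) (hM : HasFlatResolutionOfLength Λ n M) (i : ℕ) :
    Subsingleton (Abelian.Ext.{u} N M i) := by
  induction n generalizing M i with
  | zero => exact subsingleton_ext_of_isFlatRight M hM i N (hN i)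
  | succ n ih =>
    obtain ⟨F, p, hF, hp, hK⟩ := hM
    have hS := LinearMap.shortExact_shortComplexKer hp
    refine subsingleton_of_forall_eq 0 fun x => ?_
    have : Subsingleton (Abelian.Ext.{u} N p.shortComplexKer.X₁ (i + 1)) := ih _ hK (i + 1)
    have : Subsingleton (Abelian.Ext.{u} N p.shortComplexKer.X₂ i) :=
      subsingleton_ext_of_isFlatRight F hF i N (hN i)
    obtain ⟨y, rfl⟩ := Abelian.Ext.covariant_sequence_exact₃ N hS x rfl (Subsingleton.elim _ _)
    rw [Subsingleton.elim y 0, Abelian.Ext.zero_comp]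

theorem rightGrade_eq_top_iff {Λ : Type u} [Ring Λ] (N : ModuleCat.{u} Λᵐᵒᵖ) :
    rightGrade Λ N = ⊤ ↔
      ∀ t, Subsingleton (Abelian.Ext.{u} N (ModuleCat.of Λᵐᵒᵖ Λ) t) := by
  simp [rightGrade, iInf_eq_top, not_nontrivial_iff_subsingleton]

theorem hom_eq_zero_of_rightGrade_eq_top {Λ : Type u} [Ring Λ] [IsNoetherianRing Λᵐᵒᵖ]
    (N : ModuleCat.{u} Λᵐᵒᵖ) [Module.Finite Λᵐᵒᵖ N] (hN : rightGrade Λ N = ⊤)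
    (M : ModuleCat.{u} Λᵐᵒᵖ) (hM : rightFlatDimension Λ M < ⊤) (f : N →ₗ[Λᵐᵒᵖ] M) : f = 0 := by
  simp only [rightFlatDimension, iInf_lt_iff] at hM
  obtain ⟨n, hn, -⟩ := hM
  exact (subsingleton_ext_zero_iff N M).1 (subsingleton_ext_of_hasFlatResolutionOfLength N
    ((rightGrade_eq_top_iff N).1 hN) n M hn 0) f

/-! ### Injective cogenerators -/

/-- Over a left noetherian ring, direct sums of injective modules are injective. -/
theorem Module.Injective.directSum {R : Type u} [Ring R] [IsNoetherianRing R] {ι : Type*}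
    (M : ι → Type u) [∀ i, AddCommGroup (M i)] [∀ i, Module R (M i)]
    (hM : ∀ i, Module.Injective R (M i)) : Module.Injective R (DirectSum ι M) := by
  classical
  refine Module.Baer.injective fun J g => ?_
  obtain ⟨T, hT⟩ := IsNoetherian.noetherian (⊤ : Submodule R J)
  choose h hh using fun i => Module.Baer.of_injective (hM i) J (DirectSum.component R ι M i ∘ₗ g)
  -- `J` is finitely generated, so `g` lands in finitely many summands.
  let s : Finset ι := T.biUnion fun x => (g x).support
  have hs : ∀ x, ∀ i ∉ s, g x i = 0 := by
    intro x i hi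
    have hle : Submodule.span R (T : Set J) ≤
        LinearMap.ker (DirectSum.component R ι M i ∘ₗ g) := by
      rw [Submodule.span_le]
      intro z hz
      by_contra hne
      exact hi (Finset.mem_biUnion.2 ⟨z, hz, DFinsupp.mem_support_iff.2 hne⟩)
    exact hle (hT ▸ Submodule.mem_top)
  refine ⟨∑ i ∈ s, DirectSum.lof R ι M i ∘ₗ h i, fun x hx => ?_⟩
  ext i
  rw [LinearMap.sum_apply, DFinsupp.finsetSum_apply]
  by_cases hi : i ∈ s
  · rw [Finset.sum_eq_single_of_mem i hi fun j _ hj => DirectSum.of_eq_of_ne j i _ hj.symm]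
    exact (DirectSum.of_eq_same i _).trans (hh i x hx)
  · rw [hs _ i hi]
    exact Finset.sum_eq_zero fun j hj => DirectSum.of_eq_of_ne j i _ fun hij => hi (hij ▸ hj)

/-- A module that receives a nonzero homomorphism from every simple module and is injective is
a cogenerator. -/
theorem isCoseparator_of_injective {R : Type u} [Ring R] (E : ModuleCat.{u} R) [Injective E]
    (hE : ∀ S : ModuleCat.{u} R, IsSimpleModule R S → ∃ f : S →ₗ[R] E, f ≠ 0) :
    IsCoseparator E := by
  rw [isCoseparator_def]
  intro X Y f g hfg
  by_contra hne
  obtain ⟨x, hx⟩ : ∃ x, f.hom x - g.hom x ≠ 0 := by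
    by_contra! h
    exact hne (ModuleCat.hom_ext (LinearMap.ext fun x => sub_eq_zero.1 (h x)))
  set y := f.hom x - g.hom x
  let C := Submodule.span R {y}
  let c : C := ⟨y, Submodule.mem_span_singleton_self y⟩
  have : Nontrivial C := ⟨c, 0, fun h => hx (congrArg Subtype.val h)⟩
  have : Module.Finite R C := Module.Finite.span_singleton R y
  -- The simple quotient `C ⧸ m` maps nontrivially to `E`; an extension `l` to `Y` must kill `y`,
  -- which generates `C`, a contradiction.
  obtain ⟨m, hm⟩ := IsCoatomic.exists_coatom (α := Submodule R C)
  obtain ⟨s, hs⟩ := hE (ModuleCat.of R (C ⧸ m)) (isSimpleModule_iff_isCoatom.2 hm)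
  have : Mono (ModuleCat.ofHom C.subtype) :=
    (ModuleCat.mono_iff_injective _).2 C.injective_subtype
  let k : C →ₗ[R] E := s ∘ₗ m.mkQ
  let l : Y ⟶ E := Injective.factorThru (ModuleCat.ofHom k) (ModuleCat.ofHom C.subtype)
  have hl : ∀ z : C, l.hom z = k z := fun z =>
    LinearMap.congr_fun (congrArg ModuleCat.Hom.hom
      (Injective.comp_factorThru (ModuleCat.ofHom k) (ModuleCat.ofHom C.subtype))) z
  have hky : k c = 0 := by
    rw [← hl]
    change l.hom (f.hom x - g.hom x) = 0
    rw [map_sub, sub_eq_zero]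
    exact LinearMap.congr_fun (congrArg ModuleCat.Hom.hom (hfg l)) x
  have hk : k = 0 := by
    ext ⟨z, hz⟩
    obtain ⟨r, rfl⟩ := Submodule.mem_span_singleton.1 hz
    have : (⟨r • y, hz⟩ : C) = r • c := rfl
    rw [this, map_smul, hky, smul_zero, LinearMap.zero_apply]
  exact hs ((LinearMap.cancel_right m.mkQ_surjective).1 (hk.trans (LinearMap.zero_comp _).symm))

theorem exists_hom_ne_zero_of_nontrivial_ext {R : Type u} [Ring R] {N M : ModuleCat.{u} R}
    (I : InjectiveResolution M) (t : ℕ) [Nontrivial (Abelian.Ext.{u} N M t)] :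
    ∃ f : N →ₗ[R] I.cocomplex.X t, f ≠ 0 := by
  obtain ⟨α, hα⟩ := exists_ne (0 : Abelian.Ext.{u} N M t)
  obtain ⟨f, hf, rfl⟩ := I.extMk_surjective α (t + 1) rfl
  refine ⟨f.hom, fun h => hα ?_⟩
  obtain rfl : f = 0 := ModuleCat.hom_ext h
  exact I.extMk_zero _ _

theorem proposition3p2 (Λ : Type u) [Ring Λ] [IsNoetherianRing Λ] [IsNoetherianRing Λᵐᵒᵖ]
    (I : InjectiveResolution (ModuleCat.of Λᵐᵒᵖ Λ)) (hI : IsMinimalInjectiveResolution I)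
    (hfd : ∀ i : ℕ, rightFlatDimension Λ (I.cocomplex.X i) < ⊤) :
    List.TFAE
      [∀ N : ModuleCat.{u} Λᵐᵒᵖ, Module.Finite Λᵐᵒᵖ N → rightGrade Λ N = ⊤ → Subsingleton N,
       ∀ S : ModuleCat.{u} Λᵐᵒᵖ, IsSimpleModule Λᵐᵒᵖ S → rightGrade Λ S < ⊤,
       Injective (ModuleCat.of Λᵐᵒᵖ (DirectSum ℕ fun i => I.cocomplex.X i)) ∧
         IsCoseparator (ModuleCat.of Λᵐᵒᵖ (DirectSum ℕ fun i => I.cocomplex.X i))] := by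
  tfae_have 1 → 2 := by
    intro h S hS
    by_contra hlt
    have := IsSimpleModule.nontrivial Λᵐᵒᵖ S
    exact not_subsingleton S (h S inferInstance (not_lt_top_iff.1 hlt))
  tfae_have 2 → 3 := by
    intro h
    have hinj : Injective (ModuleCat.of Λᵐᵒᵖ (DirectSum ℕ fun i => I.cocomplex.X i)) := by
      rw [← Module.injective_iff_injective_object]
      refine Module.Injective.directSum _ fun i => ?_
      rw [Module.injective_iff_injective_object]
      exact I.injective i
    refine ⟨hinj, isCoseparator_of_injective _ fun S hS => ?_⟩
    have hg := h S hS
    simp only [rightGrade, iInf_lt_iff] at hg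
    obtain ⟨t, ht, -⟩ := hg
    obtain ⟨f, hf⟩ := exists_hom_ne_zero_of_nontrivial_ext (N := S) I t
    refine ⟨DirectSum.lof Λᵐᵒᵖ ℕ (fun i => I.cocomplex.X i) t ∘ₗ f, fun h0 => hf ?_⟩
    exact LinearMap.ext fun x => DirectSum.of_injective t
      ((LinearMap.congr_fun h0 x).trans (map_zero _).symm)
  tfae_have 3 → 1 := by
    rintro ⟨-, h⟩ N _ hN
    -- Every map from `N` to the direct sum is zero, so no such map separates the identity from
    -- zero.
    have hid : 𝟙 N = 0 := h.def _ _ fun k => by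
      have hk : k = 0 := by
        ext x i
        exact LinearMap.congr_fun (hom_eq_zero_of_rightGrade_eq_top N hN _ (hfd i)
          (DirectSum.component Λᵐᵒᵖ ℕ (fun i => I.cocomplex.X i) i ∘ₗ k.hom)) x
      simp [hk]
    exact subsingleton_of_forall_eq 0 fun x =>
      LinearMap.congr_fun (congrArg ModuleCat.Hom.hom hid) x
  tfae_finish
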